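/- **Setting.** Let $T>0$, $n\ge 1$, let $\pi$ be a positive $C^1$ probability density on $\mathbb R^d$, and let $s^\theta:\mathbb R^d\to\mathbb R^d$, $\theta\in\mathbb R^N$, be a parametric family of vector fields (the neural network), jointly differentiable in $(\theta,x)$. For probability densities $\rho$ and vector fields $\sigma$ put $$\mathrm{KL}(\rho\|\pi)=\mathbb E_\rho\log\tfrac{\rho}{\pi},\qquad F(\rho\|\pi)=\mathbb E_\rho\big\|\nabla\log\tfrac{\rho}{\pi}\big\|^2,\qquad L(\sigma,\rho)=\mathbb E_\rho\|\sigma-\nabla\log\rho\|^2 .$$ **Dynamics.** On a probability space let $X_t=(X^1_t,\dots,X^n_t)$ (particles in $\mathbb R^d$) and $\Theta_t\in\mathbb R^N$ (weights) be random processes, $0\le t\le T$, such that every $X^i_t$ has Lebesgue density $f_t$, the initial particles $X^1_0,\dots,X^n_0$ are independent, and almost surely, for all $t\in[0,T]$, with $s_t:=s^{\Theta_t}$, $$\frac{dX^i_t}{dt}=\nabla\log\pi(X^i_t)-s_t(X^i_t),\qquad \frac{d\Theta_t}{dt}=-\eta(t)\,\nabla_{\Theta}L^n(s^{\Theta},f_t)\Big|_{\Theta=\Theta_t},\qquad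 L^n(\sigma,f_t):=\frac1n\sum_{i=1}^n\|\sigma(X^i_t)-\nabla\log f_t(X^i_t)\|^2 .$$ (Time derivatives on $[0,T]$ are one-sided at the endpoints.) **Sufficient training.** Almost surely, for all $t\in[0,T]$: the neural tangent kernel $H^{i,j}_{\alpha,\beta}(t)=\sum_{k=1}^N\partial_{\theta_k}s_t^\alpha(X^i_t)\,\partial_{\theta_k}s_t^\beta(X^j_t)$, an $nd\times nd$ matrix, satisfies $\langle v,H(t)v\rangle\ge\lambda(t)\|v\|^2$ for all $v$, with some $\lambda(t)>0$; and $\eta(t)\ge 0$ and $$\eta(t)\ \ge\ \frac{n}{\lambda(t)}\,\frac{d}{d\tau}\Big|_{\tau=t}\log L^n(s_t,f_\tau),$$ where the weights are frozen at time $t$ while the density and the particles evolve, and the last inequality is required only at times when $L^n(s_t,f_t)>0$. ($\eta$ and $\lambda$ may depend on the realization.) **Regularity.** $f_t(x)$ is positive and jointly $C^2$ on $[0,T]\times\mathbb R^d$; $\mathrm{KL}(f_0\|\pi)<\infty$; $F(f_t\|\pi)<\infty$ for all $t\in[0,T]$; and there is an integrable $g$ on $\mathbb R^d$ with $|\partial_tf_t(x)|\,\big(1+|\log\frac{f_t(x)}{\pi(x)}|\big)\le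 g(x)$ for all $t\in[0,T]$ and all $x$. **Theorem.** Let $\varepsilon:=\inf_{0\le t\le T}F(f_t\|\pi)$. Suppose that almost surely $L^n(s_0,f_0)\le\frac14\varepsilon$, and that almost surely, for all $t\in[0,T]$, $L(s_t,f_t)<\infty$ and $|L^n(s_t,f_t)-L(s_t,f_t)|\le\frac14\varepsilon$. Then on $[0,T]$ the relative entropy $\mathrm{KL}(f_t\|\pi)$ is finite and differentiable in $t$, and $$-\frac{d}{dt}\mathrm{KL}(f_t\|\pi)\ \ge\ \frac14F(f_t\|\pi).$$ If moreover $\pi$ satisfies the log-Sobolev inequality with constant $\alpha>0$, i.e. $\mathrm{KL}(\rho\|\pi)\le\alpha F(\rho\|\pi)$ for all positive $C^1$ probability densities $\rho$ with $F(\rho\|\pi)<\infty$, then for all $t\in[0,T]$ $$\mathrm{KL}(f_t\|\pi)\le \mathrm{KL}(f_0\|\pi)\,e^{-t/(4\alpha)} .$$ -/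

import Mathlib

open MeasureTheory ProbabilityTheory Set
open scoped InformationTheory

noncomputable section

namespace SBTM

/-- State space `ℝ^d` of a particle, with the Euclidean norm. -/
abbrev State (d : ℕ) := EuclideanSpace ℝ (Fin d)

/-- Parameter space `ℝ^N` of the network weights, with the Euclidean norm. -/
abbrev Weights (N : ℕ) := EuclideanSpace ℝ (Fin N)

/-- The measure on `ℝ^d` with Lebesgue density `ρ`. -/
def densityMeasure {d : ℕ} (ρ : State d → ℝ) : Measure (State d) :=
  volume.withDensity (fun x => ENNReal.ofReal (ρ x))

/-- The score `∇ log ρ`. -/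
def score {d : ℕ} (ρ : State d → ℝ) (x : State d) : State d :=
  gradient (fun y => Real.log (ρ y)) x

/-- Relative entropy `KL(ρ ‖ π) = E_ρ log (ρ / π)` of two densities, with values in `[0, ∞]`. -/
def relEntropy {d : ℕ} (ρ π : State d → ℝ) : ENNReal :=
  InformationTheory.klDiv (densityMeasure ρ) (densityMeasure π)

/-- The integrand `‖∇ log (ρ / π)‖²` of the relative Fisher information. -/
def fisherDensity {d : ℕ} (ρ π : State d → ℝ) (x : State d) : ℝ :=
  ‖gradient (fun y => Real.log (ρ y / π y)) x‖ ^ 2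

/-- Relative Fisher information `F(ρ ‖ π) = E_ρ ‖∇ log (ρ / π)‖²`
(used only where the integrand is integrable). -/
def fisherInfo {d : ℕ} (ρ π : State d → ℝ) : ℝ :=
  ∫ x, fisherDensity ρ π x ∂(densityMeasure ρ)

/-- Score matching loss `L(σ, ρ) = E_ρ ‖σ - ∇ log ρ‖²`
(used only where the integrand is integrable). -/
def trueLoss {d : ℕ} (σ : State d → State d) (ρ : State d → ℝ) : ℝ :=
  ∫ x, ‖σ x - score ρ x‖ ^ 2 ∂(densityMeasure ρ)

/-- Training loss `Lⁿ(σ, ρ) = (1/n) ∑ i, ‖σ (x i) - ∇ log ρ (x i)‖²` on the sample `x`. -/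
def empiricalLoss {d n : ℕ} (σ : State d → State d) (ρ : State d → ℝ) (x : Fin n → State d) : ℝ :=
  (n : ℝ)⁻¹ * ∑ i, ‖σ (x i) - score ρ (x i)‖ ^ 2

/-- The partial derivative `∂ s^a (x) / ∂ θ_k` of the `a`-th output of the network. -/
def weightDeriv {d N : ℕ} (s : Weights N → State d → State d) (θ : Weights N) (x : State d)
    (k : Fin N) (a : Fin d) : ℝ :=
  (fderiv ℝ (fun θ' => s θ' x) θ (EuclideanSpace.single k 1)) a

/-- Neural tangent kernel on the sample `x`:
`H^{i,j}_{a,b} = ∑ k, ∂_{θ_k} s^a (x i) * ∂_{θ_k} s^b (x j)`. -/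
def ntk {d n N : ℕ} (s : Weights N → State d → State d) (θ : Weights N) (x : Fin n → State d) :
    Matrix (Fin n × Fin d) (Fin n × Fin d) ℝ :=
  fun p q => ∑ k, weightDeriv s θ (x p.1) k p.2 * weightDeriv s θ (x q.1) k q.2

/-- The symmetric matrix `H` is bounded below by `lam`: `⟨v, H v⟩ ≥ lam * ‖v‖²`. -/
def LowerBounded {ι : Type*} [Fintype ι] (H : Matrix ι ι ℝ) (lam : ℝ) : Prop :=
  ∀ v : ι → ℝ, lam * ∑ p, v p ^ 2 ≤ ∑ p, v p * H.mulVec v p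

/-- Log-Sobolev inequality with constant `α`: `KL(ρ ‖ π) ≤ α * F(ρ ‖ π)` for all
positive `C¹` probability densities `ρ` of finite relative Fisher information. -/
def LogSobolev {d : ℕ} (π : State d → ℝ) (α : ℝ) : Prop :=
  ∀ ρ : State d → ℝ, ContDiff ℝ 1 ρ → (∀ x, 0 < ρ x) → ∫ x, ρ x = 1 →
    Integrable (fisherDensity ρ π) (densityMeasure ρ) →
    relEntropy ρ π ≤ ENNReal.ofReal (α * fisherInfo ρ π)

/-- The coupled particle and weight dynamics on the time interval `[0, T]`:
`X i t` is the `i`-th particle, `Θ t` are the weights, `f t` is the density of the particles and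
`η` is the training rate. The time derivatives are one-sided at `0` and `T`. -/
structure Dynamics {Ω : Type*} [MeasurableSpace Ω] (P : Measure Ω) {d n N : ℕ} (T : ℝ)
    (π : State d → ℝ) (s : Weights N → State d → State d) (η : ℝ → Ω → ℝ)
    (f : ℝ → State d → ℝ) (X : Fin n → ℝ → Ω → State d) (Θ : ℝ → Ω → Weights N) : Prop where
  /-- `X i t ∼ f t`. -/
  law : ∀ i, ∀ t ∈ Icc 0 T, HasLaw (X i t) (densityMeasure (f t)) P
  /-- The initial particles are independent. -/
  indep : iIndepFun (fun i => X i 0) P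
  /-- The weights are random variables. -/
  weights : ∀ t ∈ Icc 0 T, AEMeasurable (Θ t) P
  /-- `dX/dt = ∇ log π (X) - s^Θ (X)` for each particle. -/
  particle_flow : ∀ᵐ ω ∂P, ∀ t ∈ Icc 0 T, ∀ i,
    HasDerivWithinAt (fun τ => X i τ ω) (score π (X i t ω) - s (Θ t ω) (X i t ω)) (Icc 0 T) t
  /-- `dΘ/dt = - η ∇_Θ Lⁿ(s^Θ, f)`. -/
  weight_flow : ∀ᵐ ω ∂P, ∀ t ∈ Icc 0 T,
    HasDerivWithinAt (fun τ => Θ τ ω)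
      (-(η t ω) • gradient
        (fun θ => empiricalLoss (s θ) (f t) (fun i => X i t ω)) (Θ t ω)) (Icc 0 T) t

/-- The condition of sufficient training. At each time of `[0, T]` the neural tangent kernel on the
particles is bounded below by some `lam > 0`, and the training rate satisfies `η ≥ 0` and
`η ≥ (n / lam) * d/dτ log Lⁿ(s_t, f_τ)` at `τ = t`. In this derivative the weights are frozen at
time `t`, while the density and the particles move. The logarithmic derivative is meaningful, and
the second inequality required, only where `Lⁿ(s_t, f_t) > 0`. -/
def SufficientTraining {Ω : Type*} [MeasurableSpace Ω] (P : Measure Ω) {d n N : ℕ} (T : ℝ)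
    (s : Weights N → State d → State d) (η lam : ℝ → Ω → ℝ)
    (f : ℝ → State d → ℝ) (X : Fin n → ℝ → Ω → State d) (Θ : ℝ → Ω → Weights N) : Prop :=
  ∀ᵐ ω ∂P, ∀ t ∈ Icc 0 T,
    0 < lam t ω ∧
    LowerBounded (ntk s (Θ t ω) (fun i => X i t ω)) (lam t ω) ∧
    0 ≤ η t ω ∧
    (0 < empiricalLoss (s (Θ t ω)) (f t) (fun i => X i t ω) →
      n / lam t ω * derivWithin
        (fun τ => Real.log (empiricalLoss (s (Θ t ω)) (f τ) (fun i => X i τ ω))) (Icc 0 T) t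
      ≤ η t ω)

/-- Standing regularity of the particle density on `[0, T]` relative to the target `π`. -/
structure RegularDensity {d : ℕ} (T : ℝ) (π : State d → ℝ) (f : ℝ → State d → ℝ) : Prop where
  pos : ∀ t ∈ Icc 0 T, ∀ x, 0 < f t x
  /-- `f` is `C²` jointly in time and space. -/
  contDiff : ContDiffOn ℝ 2 (fun p : ℝ × State d => f p.1 p.2) (Icc 0 T ×ˢ univ)
  /-- The initial relative entropy is finite. -/
  entropy_ne_top : relEntropy (f 0) π ≠ ⊤
  /-- The relative Fisher information is finite. -/
  fisher : ∀ t ∈ Icc 0 T, Integrable (fisherDensity (f t) π) (densityMeasure (f t))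
  /-- `(1 + |log (f / π)|) ∂f/∂t` is dominated by an integrable function uniformly in time. -/
  dominated : ∃ g : State d → ℝ, Integrable g ∧ ∀ t ∈ Icc 0 T, ∀ x,
    |derivWithin (fun τ => f τ x) (Icc 0 T) t| * (1 + |Real.log (f t x / π x)|) ≤ g x

end SBTM

end

open SBTM

namespace SBTM

open Filter Topology

/-! Training keeps the empirical loss below its initial value, and a small loss makes the particle
flow dissipate entropy almost like the exact Fokker–Planck flow.

Loss (`empiricalLoss_le_initial`). Along a trajectory, d/dt Lⁿ = -η‖G‖² + D, where G is the weight
gradient of the loss and D its derivative with frozen weights. With v the stacked residuals s(Xⁱ) -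
∇log f(Xⁱ) and H the tangent kernel, ‖G‖² = (4/n²)⟨v, Hv⟩ ≥ (4λ/n) Lⁿ (`le_norm_gradient_sq`). The
condition on η says D ≤ η(λ/n)Lⁿ, so the derivative is nonpositive and Lⁿ ≤ ε/4 for all times,
almost surely.

Entropy. The weights are random and correlated with the particles, so the weak transport equation is
written as an expectation along one particle (`RegularDensity.integral_testFunction`) rather than
with a deterministic drift. Testing it with log(f/π), admissible by the truncation in
`exists_compactSupport_approx`, gives d/dt KL = E⟨u, -u - r⟩, where u = ∇log(f/π)(X) and r is the
residual. By Young's inequality this is at most -F/2 + E‖r‖²/2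
(`RegularDensity.integral_deriv_mul_log_le`). All particles share the law f_t, so averaging over
them replaces E‖r‖² by E Lⁿ ≤ ε/4 ≤ F/4. The result is d/dt KL ≤ -3F/8, and log-Sobolev with
Grönwall gives the decay. -/

/-- Differentiation under the integral sign on a closed interval, endpoints included. -/
lemma hasDerivWithinAt_integral_of_dominated {α : Type*} [MeasurableSpace α] {μ : Measure α}
    {T t t₀ : ℝ} (ht : t ∈ Icc 0 T) (ht₀ : t₀ ∈ Icc 0 T) {F F' : ℝ → α → ℝ} {bound : α → ℝ}
    (hmeas : ∀ τ ∈ Icc 0 T, AEStronglyMeasurable (F τ) μ) (hint : Integrable (F t₀) μ)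
    (hb : Integrable bound μ)
    (hderiv : ∀ᵐ a ∂μ, ∀ τ ∈ Icc 0 T,
      HasDerivWithinAt (fun τ' => F τ' a) (F' τ a) (Icc 0 T) τ ∧ |F' τ a| ≤ bound a) :
    (∀ τ ∈ Icc 0 T, Integrable (F τ) μ) ∧
      HasDerivWithinAt (fun τ => ∫ a, F τ a ∂μ) (∫ a, F' t a ∂μ) (Icc 0 T) t := by
  -- The mean value inequality turns the derivative bound into a Lipschitz bound. It carries
  -- integrability from `t₀` to all times and dominates the difference quotients.
  have hlip : ∀ᵐ a ∂μ, ∀ x ∈ Icc 0 T, ∀ y ∈ Icc 0 T, ‖F y a - F x a‖ ≤ bound a * ‖y - x‖ := by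
    filter_upwards [hderiv] with a ha x hx y hy
    exact (convex_Icc 0 T).norm_image_sub_le_of_norm_hasDerivWithin_le
      (fun τ hτ => (ha τ hτ).1) (fun τ hτ => (ha τ hτ).2) hx hy
  have hI : ∀ τ ∈ Icc 0 T, Integrable (F τ) μ := by
    intro τ hτ
    have h : Integrable (fun a => F τ a - F t₀ a) μ := by
      refine Integrable.mono' (hb.mul_const ‖τ - t₀‖) ((hmeas τ hτ).sub (hmeas t₀ ht₀)) ?_
      filter_upwards [hlip] with a ha using ha _ ht₀ _ hτ
    exact (h.add hint).congr (ae_of_all _ fun a => by simp)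
  refine ⟨hI, ?_⟩
  rw [hasDerivWithinAt_iff_tendsto_slope]
  have key : Tendsto (fun τ => ∫ a, slope (fun τ' => F τ' a) t τ ∂μ) (𝓝[Icc 0 T \ {t}] t)
      (𝓝 (∫ a, F' t a ∂μ)) := by
    refine tendsto_integral_filter_of_dominated_convergence bound ?_ ?_ hb ?_
    · filter_upwards [self_mem_nhdsWithin] with τ hτ
      simp only [slope_def_field]
      exact ((hmeas τ hτ.1).sub (hmeas t ht)).mul_const _
    · filter_upwards [self_mem_nhdsWithin] with τ hτ
      filter_upwards [hlip] with a ha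
      have h := ha t ht τ hτ.1
      have hne : 0 < ‖τ - t‖ := norm_pos_iff.2 (sub_ne_zero.2 hτ.2)
      rw [slope_def_field, norm_div]
      exact (div_le_iff₀ hne).2 h
    · filter_upwards [hderiv] with a ha
      exact hasDerivWithinAt_iff_tendsto_slope.1 (ha t ht).1
  refine key.congr' ?_
  filter_upwards [self_mem_nhdsWithin] with τ hτ
  simp only [slope_def_field]
  rw [integral_div, integral_sub (hI τ hτ.1) (hI t ht)]

/-! ### Measures with positive densities and their relative entropy -/

section Density

variable {d : ℕ}

lemma measurable_ofReal_comp {ρ : State d → ℝ} (hρ : Continuous ρ) :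
    Measurable (fun x => ENNReal.ofReal (ρ x)) := hρ.measurable.ennreal_ofReal

lemma integral_densityMeasure {ρ : State d → ℝ} (hρ : Continuous ρ) (hpos : ∀ x, 0 < ρ x)
    (φ : State d → ℝ) : ∫ x, φ x ∂(densityMeasure ρ) = ∫ x, ρ x * φ x := by
  rw [densityMeasure, integral_withDensity_eq_integral_toReal_smul (measurable_ofReal_comp hρ)
    (ae_of_all _ fun x => ENNReal.ofReal_lt_top)]
  simp [ENNReal.toReal_ofReal (hpos _).le]

lemma integrable_densityMeasure {ρ : State d → ℝ} (hρ : Continuous ρ) (hpos : ∀ x, 0 < ρ x)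
    {φ : State d → ℝ} :
    Integrable φ (densityMeasure ρ) ↔ Integrable (fun x => ρ x * φ x) := by
  rw [densityMeasure, integrable_withDensity_iff_integrable_smul' (measurable_ofReal_comp hρ)
    (ae_of_all _ fun x => ENNReal.ofReal_lt_top)]
  simp [ENNReal.toReal_ofReal (hpos _).le]

lemma isProbabilityMeasure_densityMeasure {ρ : State d → ℝ} (hpos : ∀ x, 0 < ρ x)
    (hone : ∫ x, ρ x = 1) : IsProbabilityMeasure (densityMeasure ρ) := by
  constructor
  have hi : Integrable ρ := by
    -- A nonintegrable `ρ` would have Bochner integral 0 by convention, not 1.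
    by_contra h
    rw [integral_undef h] at hone
    exact zero_ne_one hone
  rw [densityMeasure, withDensity_apply _ MeasurableSet.univ, Measure.restrict_univ,
    ← ofReal_integral_eq_lintegral_ofReal hi (ae_of_all _ fun x => (hpos x).le), hone]
  simp

lemma densityMeasure_eq_withDensity {ρ π : State d → ℝ} (hρ : Continuous ρ) (hπ : Continuous π)
    (hπ_pos : ∀ x, 0 < π x) :
    densityMeasure ρ
      = (densityMeasure π).withDensity (fun x => ENNReal.ofReal (ρ x / π x)) := by
  have hq : Continuous fun x => ρ x / π x := hρ.div hπ fun x => (hπ_pos x).ne'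
  rw [densityMeasure, densityMeasure,
    ← withDensity_mul _ (measurable_ofReal_comp hπ) (measurable_ofReal_comp hq)]
  congr 1
  ext x
  rw [Pi.mul_apply, ← ENNReal.ofReal_mul (hπ_pos x).le, mul_div_cancel₀ _ (hπ_pos x).ne']

lemma llr_densityMeasure {ρ π : State d → ℝ} (hρ : Continuous ρ) (hπ : Continuous π)
    (hρ_pos : ∀ x, 0 < ρ x) (hπ_pos : ∀ x, 0 < π x) (hπ_one : ∫ x, π x = 1) :
    llr (densityMeasure ρ) (densityMeasure π)
      =ᵐ[densityMeasure ρ] fun x => Real.log (ρ x / π x) := by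
  have := isProbabilityMeasure_densityMeasure hπ_pos hπ_one
  have hq : Continuous fun x => ρ x / π x := hρ.div hπ fun x => (hπ_pos x).ne'
  have h := Measure.rnDeriv_withDensity (densityMeasure π) (measurable_ofReal_comp hq)
  rw [← densityMeasure_eq_withDensity hρ hπ hπ_pos] at h
  have hac : densityMeasure ρ ≪ densityMeasure π := by
    rw [densityMeasure_eq_withDensity hρ hπ hπ_pos]
    exact withDensity_absolutelyContinuous _ _
  filter_upwards [hac.ae_le h] with x hx
  rw [llr, hx, ENNReal.toReal_ofReal (div_pos (hρ_pos x) (hπ_pos x)).le]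

lemma relEntropy_ne_top_iff {ρ π : State d → ℝ} (hρ : Continuous ρ) (hπ : Continuous π)
    (hρ_pos : ∀ x, 0 < ρ x) (hπ_pos : ∀ x, 0 < π x) (hπ_one : ∫ x, π x = 1) :
    relEntropy ρ π ≠ ⊤ ↔ Integrable (fun x => ρ x * Real.log (ρ x / π x)) := by
  have hac : densityMeasure ρ ≪ densityMeasure π := by
    rw [densityMeasure_eq_withDensity hρ hπ hπ_pos]
    exact withDensity_absolutelyContinuous _ _
  rw [relEntropy, InformationTheory.klDiv_ne_top_iff,
    integrable_congr (llr_densityMeasure hρ hπ hρ_pos hπ_pos hπ_one),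
    integrable_densityMeasure hρ hρ_pos]
  exact and_iff_right hac

/-- Both measures have mass one, so the mass correction in `klDiv` cancels and only the integral of
the log-likelihood ratio remains. -/
lemma toReal_relEntropy {ρ π : State d → ℝ} (hρ : Continuous ρ) (hπ : Continuous π)
    (hρ_pos : ∀ x, 0 < ρ x) (hπ_pos : ∀ x, 0 < π x) (hρ_one : ∫ x, ρ x = 1)
    (hπ_one : ∫ x, π x = 1) :
    (relEntropy ρ π).toReal = ∫ x, ρ x * Real.log (ρ x / π x) := by
  have := isProbabilityMeasure_densityMeasure hπ_pos hπ_one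
  have := isProbabilityMeasure_densityMeasure hρ_pos hρ_one
  have hac : densityMeasure ρ ≪ densityMeasure π := by
    rw [densityMeasure_eq_withDensity hρ hπ hπ_pos]
    exact withDensity_absolutelyContinuous _ _
  rw [relEntropy, InformationTheory.toReal_klDiv_of_measure_eq hac (by simp),
    integral_congr_ae (llr_densityMeasure hρ hπ hρ_pos hπ_pos hπ_one),
    integral_densityMeasure hρ hρ_pos]

lemma integral_eq_one_of_isProbabilityMeasure {ρ : State d → ℝ} (hρ : Continuous ρ)
    (hpos : ∀ x, 0 < ρ x) [IsProbabilityMeasure (densityMeasure ρ)] : ∫ x, ρ x = 1 := by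
  simpa using (integral_densityMeasure hρ hpos fun _ => 1).symm

end Density

/-! ### Regularity of the score -/

section Score

variable {d : ℕ}

lemma continuous_score {ρ : State d → ℝ} (hρ : ContDiff ℝ 1 ρ) (hpos : ∀ x, 0 < ρ x) :
    Continuous (score ρ) :=
  (InnerProductSpace.toDual ℝ (State d)).symm.continuous.comp
    ((hρ.log fun x => (hpos x).ne').continuous_fderiv one_ne_zero)

/-- `∇ log (ρ / π) = ∇ log ρ - ∇ log π`. -/
lemma gradient_log_div {ρ π : State d → ℝ} (hρ : ContDiff ℝ 1 ρ) (hπ : ContDiff ℝ 1 π)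
    (hρ_pos : ∀ x, 0 < ρ x) (hπ_pos : ∀ x, 0 < π x) (x : State d) :
    gradient (fun y => Real.log (ρ y / π y)) x = score ρ x - score π x := by
  have h : (fun y => Real.log (ρ y / π y)) = fun y => Real.log (ρ y) - Real.log (π y) := by
    ext y
    exact Real.log_div (hρ_pos y).ne' (hπ_pos y).ne'
  have h1 := ((hρ.log fun x => (hρ_pos x).ne').differentiable one_ne_zero) x
  have h2 := ((hπ.log fun x => (hπ_pos x).ne').differentiable one_ne_zero) x
  rw [h, score, score, gradient, gradient, gradient, fderiv_fun_sub h1 h2, map_sub]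

variable {T : ℝ} {f : ℝ → State d → ℝ}

lemma contDiff_slice (hcd : ContDiffOn ℝ 2 (fun p : ℝ × State d => f p.1 p.2) (Icc 0 T ×ˢ univ))
    {t : ℝ} (ht : t ∈ Icc 0 T) : ContDiff ℝ 2 (f t) :=
  hcd.comp_contDiff (g := fun p : ℝ × State d => f p.1 p.2)
    (f := fun x : State d => (t, x)) (by fun_prop) fun x => ⟨ht, mem_univ x⟩

lemma contDiffOn_time
    (hcd : ContDiffOn ℝ 2 (fun p : ℝ × State d => f p.1 p.2) (Icc 0 T ×ˢ univ))
    (x : State d) : ContDiffOn ℝ 2 (fun τ => f τ x) (Icc 0 T) :=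
  hcd.comp (g := fun p : ℝ × State d => f p.1 p.2) (f := fun τ : ℝ => (τ, x)) (by fun_prop)
    fun τ hτ => ⟨hτ, mem_univ x⟩

/-- The score of a jointly `C²` positive density is jointly differentiable. -/
lemma differentiableOn_score (hT : 0 < T)
    (hcd : ContDiffOn ℝ 2 (fun p : ℝ × State d => f p.1 p.2) (Icc 0 T ×ˢ univ))
    (hpos : ∀ t ∈ Icc 0 T, ∀ x, 0 < f t x) :
    DifferentiableOn ℝ (fun p : ℝ × State d => score (f p.1) p.2) (Icc 0 T ×ˢ univ) := by
  have hU : UniqueDiffOn ℝ (Icc 0 T ×ˢ (univ : Set (State d))) :=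
    (uniqueDiffOn_Icc hT).prod uniqueDiffOn_univ
  have hlog : ContDiffOn ℝ 2 (fun p : ℝ × State d => Real.log (f p.1 p.2)) (Icc 0 T ×ˢ univ) :=
    hcd.log fun p hp => (hpos p.1 hp.1 p.2).ne'
  have h1 := (hlog.fderivWithin hU (m := 1) (by norm_num)).differentiableOn one_ne_zero
  -- The score is the Riesz dual of the spatial part of the joint derivative of `log f`, and that
  -- derivative is C¹ because `f` is C².
  have h2 : DifferentiableOn ℝ (fun p : ℝ × State d =>
      (InnerProductSpace.toDual ℝ (State d)).symm
        ((fderivWithin ℝ (fun p : ℝ × State d => Real.log (f p.1 p.2)) (Icc 0 T ×ˢ univ) p).comp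
          (ContinuousLinearMap.inr ℝ ℝ (State d)))) (Icc 0 T ×ˢ univ) :=
    (InnerProductSpace.toDual ℝ (State d)).symm.toContinuousLinearEquiv.differentiable
      |>.comp_differentiableOn (h1.clm_comp (differentiableOn_const _))
  refine h2.congr fun p hp => ?_
  rw [score, gradient]
  congr 1
  have h3 := ((hlog.differentiableOn two_ne_zero) p hp).hasFDerivWithinAt
  have h4 : HasFDerivWithinAt (fun x : State d => (p.1, x))
      (ContinuousLinearMap.inr ℝ ℝ (State d)) univ p.2 :=
    (hasFDerivAt_prodMk_right p.1 p.2).hasFDerivWithinAt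
  have h5 := HasFDerivWithinAt.comp (g := fun p : ℝ × State d => Real.log (f p.1 p.2))
    p.2 h3 h4 (show MapsTo (fun x : State d => (p.1, x)) univ (Icc 0 T ×ˢ univ) from
      fun x _ => ⟨hp.1, mem_univ x⟩)
  exact (hasFDerivWithinAt_univ.1 h5).fderiv

end Score

/-! ### Monotonicity of the training loss -/

section TrainingLoss

variable {d n N : ℕ}

/-- One term of a sum of squares is at most the sum. This makes a bound on the loss a uniform bound
on each particle's score error. -/
lemma norm_sq_le_empiricalLoss (hn : 0 < n) (σ : State d → State d) (ρ : State d → ℝ)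
    (x : Fin n → State d) (i : Fin n) :
    ‖σ (x i) - score ρ (x i)‖ ^ 2 ≤ n * empiricalLoss σ ρ x := by
  have hn' : (n : ℝ) ≠ 0 := by positivity
  rw [empiricalLoss, mul_inv_cancel_left₀ hn']
  exact Finset.single_le_sum (f := fun i => ‖σ (x i) - score ρ (x i)‖ ^ 2)
    (fun j _ => sq_nonneg _) (Finset.mem_univ i)

lemma empiricalLoss_nonneg (σ : State d → State d) (ρ : State d → ℝ) (x : Fin n → State d) :
    0 ≤ empiricalLoss σ ρ x := by
  unfold empiricalLoss
  positivity

lemma hasFDerivAt_empiricalLoss {s : Weights N → State d → State d} {θ : Weights N}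
    (ρ : State d → ℝ) (x : Fin n → State d)
    (hs : ∀ y, DifferentiableAt ℝ (fun θ' => s θ' y) θ) :
    HasFDerivAt (fun θ' => empiricalLoss (s θ') ρ x)
      ((n : ℝ)⁻¹ • ∑ i, 2 • (innerSL ℝ (s θ (x i) - score ρ (x i))).comp
        (fderiv ℝ (fun θ' => s θ' (x i)) θ)) θ := by
  unfold empiricalLoss
  refine HasFDerivAt.const_mul (HasFDerivAt.fun_sum fun i _ => ?_) _
  exact ((hs (x i)).hasFDerivAt.sub_const _).norm_sq

lemma inner_gradient_empiricalLoss {s : Weights N → State d → State d} {θ : Weights N}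
    (ρ : State d → ℝ) (x : Fin n → State d)
    (hs : ∀ y, DifferentiableAt ℝ (fun θ' => s θ' y) θ) (w : Weights N) :
    inner ℝ (gradient (fun θ' => empiricalLoss (s θ') ρ x) θ) w
      = 2 / n * ∑ i, inner ℝ (s θ (x i) - score ρ (x i))
          (fderiv ℝ (fun θ' => s θ' (x i)) θ w) := by
  rw [gradient, InnerProductSpace.toDual_symm_apply, (hasFDerivAt_empiricalLoss ρ x hs).fderiv]
  simp only [smul_apply, sum_apply,
    ContinuousLinearMap.comp_apply, innerSL_apply_apply, smul_eq_mul, nsmul_eq_mul]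
  rw [← Finset.mul_sum]
  push_cast
  ring

/-- A lower bound of the tangent kernel makes the gradient of the training loss dominate the
loss. -/
lemma le_norm_gradient_sq {s : Weights N → State d → State d} {θ : Weights N}
    (hn : 0 < n) (ρ : State d → ℝ) (x : Fin n → State d)
    (hs : ∀ y, DifferentiableAt ℝ (fun θ' => s θ' y) θ) {l : ℝ}
    (hH : LowerBounded (ntk s θ x) l) :
    4 * l / n * empiricalLoss (s θ) ρ x
      ≤ ‖gradient (fun θ' => empiricalLoss (s θ') ρ x) θ‖ ^ 2 := by
  have hn' : (0 : ℝ) < n := by positivity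
  -- With J the Jacobian of the stacked outputs in the weights, the gradient is (2/n)Jᵀv and the
  -- kernel is JJᵀ, hence ‖∇‖² = (4/n²)⟨v, Hv⟩.
  set v : Fin n × Fin d → ℝ := fun p => (s θ (x p.1) - score ρ (x p.1)) p.2 with hv
  have hcoord : ∀ k, gradient (fun θ' => empiricalLoss (s θ') ρ x) θ k
      = 2 / n * ∑ p : Fin n × Fin d, v p * weightDeriv s θ (x p.1) k p.2 := by
    intro k
    have h := inner_gradient_empiricalLoss ρ x hs (EuclideanSpace.single k 1)
    rw [EuclideanSpace.inner_single_right] at h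
    simp only [one_mul, conj_trivial] at h
    rw [h, Fintype.sum_prod_type]
    congr 1
    refine Finset.sum_congr rfl fun i _ => ?_
    rw [PiLp.inner_apply]
    refine Finset.sum_congr rfl fun a _ => ?_
    simp [hv, weightDeriv, mul_comm]
  have hnorm : ∑ p, v p ^ 2 = n * empiricalLoss (s θ) ρ x := by
    rw [empiricalLoss, mul_inv_cancel_left₀ hn'.ne', Fintype.sum_prod_type]
    refine Finset.sum_congr rfl fun i _ => ?_
    rw [EuclideanSpace.real_norm_sq_eq]
  have hquad : ∑ p, v p * (ntk s θ x).mulVec v p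
      = ∑ k, (∑ p : Fin n × Fin d, v p * weightDeriv s θ (x p.1) k p.2) ^ 2 := by
    simp only [Matrix.mulVec, dotProduct, ntk, Finset.sum_mul, Finset.mul_sum, sq]
    rw [Finset.sum_comm_cycle]
    refine Finset.sum_congr rfl fun k _ => ?_
    rw [Finset.sum_comm]
    refine Finset.sum_congr rfl fun p _ => Finset.sum_congr rfl fun q _ => ?_
    ring
  rw [EuclideanSpace.real_norm_sq_eq]
  simp only [hcoord, mul_pow]
  rw [← Finset.mul_sum, ← hquad]
  calc 4 * l / n * empiricalLoss (s θ) ρ x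
      = (2 / n) ^ 2 * (l * ∑ p, v p ^ 2) := by rw [hnorm]; field_simp; ring
    _ ≤ _ := mul_le_mul_of_nonneg_left (hH v) (by positivity)

/-- Along a trajectory of particles and weights with sufficient training, the training loss is
nonincreasing. -/
lemma empiricalLoss_le_initial {T : ℝ} (hT : 0 < T) (hn : 0 < n) {f : ℝ → State d → ℝ}
    (hcd : ContDiffOn ℝ 2 (fun p : ℝ × State d => f p.1 p.2) (Icc 0 T ×ˢ univ))
    (hpos : ∀ t ∈ Icc 0 T, ∀ x, 0 < f t x)
    {s : Weights N → State d → State d}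
    (hs : Differentiable ℝ (fun p : Weights N × State d => s p.1 p.2))
    {x x' : Fin n → ℝ → State d} {θ : ℝ → Weights N} {η lam : ℝ → ℝ}
    (hx : ∀ t ∈ Icc 0 T, ∀ i, HasDerivWithinAt (x i) (x' i t) (Icc 0 T) t)
    (hθ : ∀ t ∈ Icc 0 T, HasDerivWithinAt θ
      (-(η t) • gradient (fun θ' => empiricalLoss (s θ') (f t) (fun i => x i t)) (θ t))
      (Icc 0 T) t)
    (htrain : ∀ t ∈ Icc 0 T, 0 < lam t ∧ LowerBounded (ntk s (θ t) (fun i => x i t)) (lam t) ∧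
      0 ≤ η t ∧ (0 < empiricalLoss (s (θ t)) (f t) (fun i => x i t) →
        n / lam t * derivWithin
          (fun τ => Real.log (empiricalLoss (s (θ t)) (f τ) (fun i => x i τ))) (Icc 0 T) t
        ≤ η t))
    {t : ℝ} (ht : t ∈ Icc 0 T) :
    empiricalLoss (s (θ t)) (f t) (fun i => x i t)
      ≤ empiricalLoss (s (θ 0)) (f 0) (fun i => x i 0) := by
  have hn' : (0 : ℝ) < n := by positivity
  suffices h : ∀ t ∈ Icc 0 T, ∃ D ≤ 0, HasDerivWithinAt
      (fun τ => empiricalLoss (s (θ τ)) (f τ) (fun i => x i τ)) D (Icc 0 T) t by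
    have hanti : AntitoneOn (fun τ => empiricalLoss (s (θ τ)) (f τ) (fun i => x i τ))
        (Icc 0 T) := by
      refine antitoneOn_of_deriv_nonpos (convex_Icc 0 T) (fun τ hτ => ?_) (fun τ hτ => ?_)
        (fun τ hτ => ?_)
      · obtain ⟨D, -, hD⟩ := h τ hτ
        exact hD.continuousWithinAt
      · obtain ⟨D, -, hD⟩ := h τ (interior_subset hτ)
        exact (hD.hasDerivAt (mem_interior_iff_mem_nhds.1 hτ)).differentiableAt.differentiableWithinAt
      · obtain ⟨D, hD0, hD⟩ := h τ (interior_subset hτ)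
        rwa [(hD.hasDerivAt (mem_interior_iff_mem_nhds.1 hτ)).deriv]
    exact hanti ⟨le_rfl, hT.le⟩ ht ht.1
  clear ht
  intro t ht
  obtain ⟨hlam, hH, hη, hrate⟩ := htrain t ht
  have hs1 : ∀ y, DifferentiableAt ℝ (fun θ' => s θ' y) (θ t) := fun y =>
    (hs (θ t, y)).comp (f := fun θ' : Weights N => (θ', y)) (θ t) (by fun_prop)
  set G := gradient (fun θ' => empiricalLoss (s θ') (f t) (fun i => x i t)) (θ t) with hG
  set ℓ := empiricalLoss (s (θ t)) (f t) (fun i => x i t) with hℓ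
  -- the scores along the trajectories
  have hscore : ∀ i, ∃ σ' : State d,
      HasDerivWithinAt (fun τ => score (f τ) (x i τ)) σ' (Icc 0 T) t := by
    intro i
    have h1 := (differentiableOn_score hT hcd hpos (t, x i t) ⟨ht, mem_univ _⟩).hasFDerivWithinAt
    have h2 : HasDerivWithinAt (fun τ => (τ, x i τ)) ((1 : ℝ), x' i t) (Icc 0 T) t :=
      (hasDerivWithinAt_id t _).prodMk (hx t ht i)
    exact ⟨_, HasFDerivWithinAt.comp_hasDerivWithinAt
      (l := fun p : ℝ × State d => score (f p.1) p.2) (f := fun τ => (τ, x i τ)) t h1 h2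
      (show MapsTo (fun τ => (τ, x i τ)) (Icc 0 T) (Icc 0 T ×ˢ univ) from
        fun τ hτ => ⟨hτ, mem_univ _⟩)⟩
  choose σ' hσ' using hscore
  set B : Fin n → State d := fun i =>
    fderiv ℝ (fun p : Weights N × State d => s p.1 p.2) (θ t, x i t) (0, x' i t) with hB
  have hfrozen : ∀ i, HasDerivWithinAt (fun τ => s (θ t) (x i τ) - score (f τ) (x i τ))
      (B i - σ' i) (Icc 0 T) t := by
    intro i
    have h2 : HasDerivWithinAt (fun τ => (θ t, x i τ)) ((0 : Weights N), x' i t) (Icc 0 T) t :=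
      (hasDerivWithinAt_const t _ _).prodMk (hx t ht i)
    exact ((hs (θ t, x i t)).hasFDerivAt.comp_hasDerivWithinAt t h2).sub (hσ' i)
  have hmoving : ∀ i, HasDerivWithinAt (fun τ => s (θ τ) (x i τ) - score (f τ) (x i τ))
      (fderiv ℝ (fun θ' => s θ' (x i t)) (θ t) (-(η t) • G) + (B i - σ' i)) (Icc 0 T) t := by
    intro i
    have h2 : HasDerivWithinAt (fun τ => (θ τ, x i τ)) (-(η t) • G, x' i t) (Icc 0 T) t :=
      (hθ t ht).prodMk (hx t ht i)
    have h3 := ((hs (θ t, x i t)).hasFDerivAt.comp_hasDerivWithinAt t h2).sub (hσ' i)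
    have h4 : HasFDerivAt (fun θ' => s θ' (x i t))
        ((fderiv ℝ (fun p : Weights N × State d => s p.1 p.2) (θ t, x i t)).comp
          (ContinuousLinearMap.inl ℝ (Weights N) (State d))) (θ t) :=
      (hs (θ t, x i t)).hasFDerivAt.comp (f := fun θ' : Weights N => (θ', x i t)) (θ t)
        (hasFDerivAt_prodMk_left _ _)
    have h5 : fderiv ℝ (fun θ' => s θ' (x i t)) (θ t) (-(η t) • G) + B i
        = fderiv ℝ (fun p : Weights N × State d => s p.1 p.2) (θ t, x i t)
          (-(η t) • G, x' i t) := by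
      rw [h4.fderiv, ContinuousLinearMap.comp_apply, ContinuousLinearMap.inl_apply, hB,
        ← map_add]
      simp
    rw [← add_sub_assoc, h5]
    exact h3
  have hloss_frozen : HasDerivWithinAt
      (fun τ => empiricalLoss (s (θ t)) (f τ) (fun i => x i τ))
      ((n : ℝ)⁻¹ * ∑ i, 2 * inner ℝ (s (θ t) (x i t) - score (f t) (x i t)) (B i - σ' i))
      (Icc 0 T) t :=
    (HasDerivWithinAt.fun_sum fun i _ => (hfrozen i).norm_sq).const_mul _
  have hloss : HasDerivWithinAt
      (fun τ => empiricalLoss (s (θ τ)) (f τ) (fun i => x i τ))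
      ((n : ℝ)⁻¹ * ∑ i, 2 * inner ℝ (s (θ t) (x i t) - score (f t) (x i t))
        (fderiv ℝ (fun θ' => s θ' (x i t)) (θ t) (-(η t) • G) + (B i - σ' i)))
      (Icc 0 T) t :=
    (HasDerivWithinAt.fun_sum fun i _ => (hmoving i).norm_sq).const_mul _
  refine ⟨_, ?_, hloss⟩
  set D := (n : ℝ)⁻¹ * ∑ i, 2 * inner ℝ (s (θ t) (x i t) - score (f t) (x i t)) (B i - σ' i)
    with hD
  -- The moving weights contribute the pairing of `G` with `-η G`; the rest is the frozen-weight
  -- derivative `D`.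
  have hsplit : (n : ℝ)⁻¹ * ∑ i, 2 * inner ℝ (s (θ t) (x i t) - score (f t) (x i t))
        (fderiv ℝ (fun θ' => s θ' (x i t)) (θ t) (-(η t) • G) + (B i - σ' i))
      = -(η t) * ‖G‖ ^ 2 + D := by
    have h := inner_gradient_empiricalLoss (f t) (fun i => x i t) hs1 (-(η t) • G)
    rw [← hG, real_inner_smul_right, real_inner_self_eq_norm_sq] at h
    rw [h, hD]
    simp only [inner_add_right, mul_add, Finset.sum_add_distrib, ← Finset.mul_sum]
    ring
  rw [hsplit]
  -- At zero loss the rate condition is not available, but every residual vanishes, so `D = 0` and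
  -- `η ≥ 0` suffices.
  rcases (empiricalLoss_nonneg (s (θ t)) (f t) (fun i => x i t)).eq_or_lt with h0 | h0
  · have hz : ∀ i, s (θ t) (x i t) - score (f t) (x i t) = 0 := by
      intro i
      have h := norm_sq_le_empiricalLoss hn (s (θ t)) (f t) (fun i => x i t) i
      rw [← h0, mul_zero] at h
      exact norm_eq_zero.1 (pow_eq_zero_iff two_ne_zero |>.1 (le_antisymm h (sq_nonneg _)))
    have hD0 : D = 0 := by simp [hD, hz]
    rw [hD0, add_zero, neg_mul]
    exact neg_nonpos.2 (mul_nonneg hη (sq_nonneg _))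
  · replace h0 : 0 < ℓ := h0
    have hlog : derivWithin
        (fun τ => Real.log (empiricalLoss (s (θ t)) (f τ) (fun i => x i τ))) (Icc 0 T) t
        = D / ℓ :=
      (hloss_frozen.log h0.ne').derivWithin (uniqueDiffOn_Icc hT t ht)
    have h1 := hrate h0
    rw [hlog] at h1
    have h2 := le_norm_gradient_sq hn (f t) (fun i => x i t) hs1 hH
    rw [← hG, ← hℓ] at h2
    have h3 : D ≤ η t * (lam t / n * ℓ) := by
      have : D = n / lam t * (D / ℓ) * (lam t / n * ℓ) := by field_simp
      rw [this]
      exact mul_le_mul_of_nonneg_right h1 (by positivity)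
    -- The kernel bound has a factor 4 to spare.
    have h4 : lam t / n * ℓ ≤ ‖G‖ ^ 2 := by
      refine le_trans ?_ h2
      have : 0 ≤ lam t / n * ℓ := by positivity
      calc lam t / n * ℓ ≤ 4 * (lam t / n * ℓ) := by linarith
        _ = _ := by ring
    have h5 := mul_le_mul_of_nonneg_left h4 hη
    linarith

end TrainingLoss

/-! ### Truncation to compactly supported test functions -/

lemma abs_arctan_le (y : ℝ) : |Real.arctan y| ≤ |y| := by
  have h := convex_univ.norm_image_sub_le_of_norm_deriv_le (f := Real.arctan) (C := 1)
    (fun x _ => Real.differentiableAt_arctan x) (fun x _ => ?_) (mem_univ 0) (mem_univ y)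
  · simpa using h
  · rw [Real.deriv_arctan, Real.norm_eq_abs, abs_of_nonneg (by positivity)]
    exact (div_le_one (by positivity)).2 (by nlinarith [sq_nonneg x])

/-- A `C¹` function is a limit of compactly supported `C¹` functions, with control of the values and
of the derivatives. -/
lemma exists_compactSupport_approx {d : ℕ} {h : State d → ℝ} (hh : ContDiff ℝ 1 h) :
    ∃ (C : ℝ) (φ : ℕ → State d → ℝ), 0 ≤ C ∧
      (∀ k, ContDiff ℝ 1 (φ k)) ∧ (∀ k, HasCompactSupport (φ k)) ∧
      (∀ k x, |φ k x| ≤ |h x|) ∧ (∀ x, Tendsto (fun k => φ k x) atTop (𝓝 (h x))) ∧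
      (∀ k x v, |fderiv ℝ (φ k) x v| ≤ (‖fderiv ℝ h x‖ + C) * ‖v‖) ∧
      (∀ x v, Tendsto (fun k => fderiv ℝ (φ k) x v) atTop (𝓝 (fderiv ℝ h x v))) := by
  let χ : ContDiffBump (0 : State d) := ⟨1, 2, one_pos, one_lt_two⟩
  have hχ1 : ContDiff ℝ 1 χ := χ.contDiff
  obtain ⟨C, hC⟩ := (χ.hasCompactSupport.fderiv ℝ).exists_bound_of_continuous
    (hχ1.continuous_fderiv one_ne_zero)
  have hC0 : 0 ≤ C := (norm_nonneg _).trans (hC 0)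
  let c : ℕ → ℝ := fun k => (k : ℝ) + 1
  have hc1 : ∀ k, 1 ≤ c k := fun k => by simp [c]
  have hc0 : ∀ k, 0 < c k := fun k => one_pos.trans_le (hc1 k)
  have hcinv : Tendsto (fun k => (c k)⁻¹) atTop (𝓝 0) :=
    tendsto_inv_atTop_zero.comp (tendsto_atTop_add_const_right _ _ tendsto_natCast_atTop_atTop)
  -- The factor `c * arctan (h / c)` caps the values at order `c` without increasing `|h|` or
  -- `‖∇h‖`. The cutoff lives at scale `c²`, so its gradient, of order `c⁻²`, contributes only
  -- `O(c⁻¹)` to the derivative, with no growth condition on `h`.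
  let φ : ℕ → State d → ℝ := fun k x =>
    χ ((c k)⁻¹ ^ 2 • x) * (c k * Real.arctan ((c k)⁻¹ * h x))
  have hderiv : ∀ k x v, fderiv ℝ (φ k) x v
      = χ ((c k)⁻¹ ^ 2 • x) * ((1 + ((c k)⁻¹ * h x) ^ 2)⁻¹ * fderiv ℝ h x v)
        + (c k)⁻¹ * (Real.arctan ((c k)⁻¹ * h x) * fderiv ℝ χ ((c k)⁻¹ ^ 2 • x) v) := by
    intro k x v
    have h1 : HasFDerivAt (fun x => χ ((c k)⁻¹ ^ 2 • x))
        ((fderiv ℝ χ ((c k)⁻¹ ^ 2 • x)).comp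
          ((c k)⁻¹ ^ 2 • ContinuousLinearMap.id ℝ (State d))) x :=
      ((hχ1.differentiable one_ne_zero) _).hasFDerivAt.comp x
        ((hasFDerivAt_id x).const_smul ((c k)⁻¹ ^ 2))
    have h2 := ((((hh.differentiable one_ne_zero) x).hasFDerivAt.const_mul
      (c k)⁻¹).arctan).const_mul (c k)
    have h3 : HasFDerivAt (φ k) _ x := h1.mul h2
    have hck := (hc0 k).ne'
    rw [h3.fderiv]
    simp
    field_simp
  have harc : ∀ k y, |Real.arctan ((c k)⁻¹ * y)| ≤ (c k)⁻¹ * |y| := fun k y => by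
    have := abs_arctan_le ((c k)⁻¹ * y)
    rwa [abs_mul, abs_of_pos (inv_pos.2 (hc0 k))] at this
  have hpi : ∀ y, |Real.arctan y| ≤ 2 := fun y => by
    rw [abs_le]
    constructor <;>
      linarith [Real.arctan_lt_pi_div_two y, Real.neg_pi_div_two_lt_arctan y, Real.pi_le_four]
  have hsecond : ∀ k x v,
      |(c k)⁻¹ * (Real.arctan ((c k)⁻¹ * h x) * fderiv ℝ χ ((c k)⁻¹ ^ 2 • x) v)|
        ≤ (c k)⁻¹ * (2 * C * ‖v‖) := by
    intro k x v
    rw [abs_mul, abs_of_pos (inv_pos.2 (hc0 k)), abs_mul, mul_assoc 2]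
    refine mul_le_mul_of_nonneg_left ?_ (inv_pos.2 (hc0 k)).le
    refine mul_le_mul (hpi _) ?_ (abs_nonneg _) zero_le_two
    exact ((fderiv ℝ χ ((c k)⁻¹ ^ 2 • x)).le_opNorm v).trans
      (mul_le_mul_of_nonneg_right (hC _) (norm_nonneg v))
  have hχlim : ∀ x, Tendsto (fun k => χ ((c k)⁻¹ ^ 2 • x)) atTop (𝓝 1) := by
    intro x
    have h1 : Tendsto (fun k => (c k)⁻¹ ^ 2 • x) atTop (𝓝 0) := by
      simpa using (hcinv.pow 2).smul_const x
    have h2 := (χ.continuous.tendsto 0).comp h1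
    rwa [χ.one_of_mem_closedBall (Metric.mem_closedBall_self χ.rIn_pos.le)] at h2
  refine ⟨2 * C, φ, by positivity, ?_, ?_, ?_, ?_, ?_, ?_⟩
  · intro k
    exact (hχ1.comp (contDiff_const_smul _)).mul
      (contDiff_const.mul (contDiff_const.mul hh).arctan)
  · intro k
    exact (χ.hasCompactSupport.comp_smul (pow_ne_zero 2 (inv_ne_zero (hc0 k).ne'))).mul_right
  · intro k x
    rw [abs_mul, abs_of_nonneg χ.nonneg, abs_mul, abs_of_pos (hc0 k)]
    calc χ ((c k)⁻¹ ^ 2 • x) * (c k * |Real.arctan ((c k)⁻¹ * h x)|)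
        ≤ 1 * (c k * ((c k)⁻¹ * |h x|)) :=
          mul_le_mul χ.le_one (mul_le_mul_of_nonneg_left (harc k _) (hc0 k).le)
            (mul_nonneg (hc0 k).le (abs_nonneg _)) zero_le_one
      _ = |h x| := by rw [one_mul, mul_inv_cancel_left₀ (hc0 k).ne']
  · intro x
    -- `c * arctan (h / c)` is a difference quotient at 0 of `y ↦ arctan (y h)`, whose derivative
    -- there is `h`.
    have h1 : HasDerivAt (fun y => Real.arctan (y * h x)) (h x) 0 := by
      simpa using ((hasDerivAt_id (0 : ℝ)).mul_const (h x)).arctan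
    have h2 : Tendsto (fun k => (c k)⁻¹) atTop (𝓝[>] 0) :=
      tendsto_nhdsWithin_iff.2 ⟨hcinv, Eventually.of_forall fun k => inv_pos.2 (hc0 k)⟩
    have h3 := h1.tendsto_slope_zero_right.comp h2
    have h4 := (hχlim x).mul h3
    simpa [φ, Function.comp_def] using h4
  · intro k x v
    rw [hderiv, add_mul]
    refine (abs_add_le _ _).trans (add_le_add ?_ ((hsecond k x v).trans ?_))
    · rw [abs_mul, abs_of_nonneg χ.nonneg, abs_mul, abs_of_nonneg (by positivity)]
      have h1 : (1 + ((c k)⁻¹ * h x) ^ 2)⁻¹ ≤ 1 :=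
        inv_le_one_of_one_le₀ (by nlinarith [sq_nonneg ((c k)⁻¹ * h x)])
      calc χ ((c k)⁻¹ ^ 2 • x) * ((1 + ((c k)⁻¹ * h x) ^ 2)⁻¹ * |fderiv ℝ h x v|)
          ≤ 1 * (1 * |fderiv ℝ h x v|) :=
            mul_le_mul χ.le_one (mul_le_mul_of_nonneg_right h1 (abs_nonneg _))
              (by positivity) zero_le_one
        _ ≤ _ := by simpa using (fderiv ℝ h x).le_opNorm v
    · exact mul_le_of_le_one_left (by positivity) (inv_le_one_of_one_le₀ (hc1 k))
  · intro x v
    simp only [hderiv]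
    have h1 : Tendsto (fun k => (1 + ((c k)⁻¹ * h x) ^ 2)⁻¹) atTop (𝓝 1) := by
      have := (((hcinv.mul_const (h x)).pow 2).const_add 1).inv₀ (by simp)
      simpa using this
    have h2 : Tendsto (fun k =>
        (c k)⁻¹ * (Real.arctan ((c k)⁻¹ * h x) * fderiv ℝ χ ((c k)⁻¹ ^ 2 • x) v))
        atTop (𝓝 0) := by
      refine squeeze_zero_norm (fun k => hsecond k x v) ?_
      simpa using hcinv.mul_const (2 * C * ‖v‖)
    simpa using ((hχlim x).mul (h1.mul_const (fderiv ℝ h x v))).add h2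

/-! ### Differentiating the relative entropy in time -/

section Entropy

variable {d : ℕ} {T : ℝ} {π : State d → ℝ} {f : ℝ → State d → ℝ}

lemma RegularDensity.hasDerivWithinAt (hf : RegularDensity T π f) {t : ℝ} (ht : t ∈ Icc 0 T)
    (x : State d) : HasDerivWithinAt (fun τ => f τ x)
      (derivWithin (fun τ => f τ x) (Icc 0 T) t) (Icc 0 T) t :=
  ((contDiffOn_time hf.contDiff x).differentiableOn two_ne_zero t ht).hasDerivWithinAt

lemma RegularDensity.contDiff_one (hf : RegularDensity T π f) {t : ℝ} (ht : t ∈ Icc 0 T) :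
    ContDiff ℝ 1 (f t) := (contDiff_slice hf.contDiff ht).of_le one_le_two

lemma abs_deriv_le {g : State d → ℝ} {t : ℝ} {x : State d}
    (h : |derivWithin (fun τ => f τ x) (Icc 0 T) t| * (1 + |Real.log (f t x / π x)|) ≤ g x) :
    |derivWithin (fun τ => f τ x) (Icc 0 T) t| ≤ g x :=
  (le_mul_of_one_le_right (abs_nonneg _) (by simp)).trans h

lemma RegularDensity.continuous_deriv (hf : RegularDensity T π f) (hT : 0 < T) {t : ℝ}
    (ht : t ∈ Icc 0 T) : Continuous fun x => derivWithin (fun τ => f τ x) (Icc 0 T) t := by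
  have hU : UniqueDiffOn ℝ (Icc 0 T ×ˢ (univ : Set (State d))) :=
    (uniqueDiffOn_Icc hT).prod uniqueDiffOn_univ
  have h1 : Continuous fun x =>
      fderivWithin ℝ (fun p : ℝ × State d => f p.1 p.2) (Icc 0 T ×ˢ univ) (t, x) (1, 0) :=
    ((hf.contDiff.continuousOn_fderivWithin hU (by norm_num)).comp_continuous
      (by fun_prop : Continuous fun x : State d => (t, x))
      fun x => ⟨ht, mem_univ x⟩).clm_apply continuous_const
  refine h1.congr fun x => ?_
  have h2 := (hf.contDiff.differentiableOn two_ne_zero (t, x) ⟨ht, mem_univ x⟩).hasFDerivWithinAt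
  have h3 : HasDerivWithinAt (fun τ => (τ, x)) ((1 : ℝ), (0 : State d)) (Icc 0 T) t :=
    (hasDerivWithinAt_id t _).prodMk (hasDerivWithinAt_const t _ x)
  have h4 := HasFDerivWithinAt.comp_hasDerivWithinAt
    (l := fun p : ℝ × State d => f p.1 p.2) (f := fun τ => (τ, x)) t h2 h3
    (show MapsTo (fun τ => (τ, x)) (Icc 0 T) (Icc 0 T ×ˢ univ) from
      fun τ hτ => ⟨hτ, mem_univ _⟩)
  exact (h4.derivWithin (uniqueDiffOn_Icc hT t ht)).symm

/-- The relative entropy along a regular curve of probability densities is finite and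
differentiable. -/
lemma RegularDensity.relEntropy_deriv (hf : RegularDensity T π f) (hT : 0 < T)
    (hπ : Continuous π) (hπ_pos : ∀ x, 0 < π x) (hπ_one : ∫ x, π x = 1)
    (hone : ∀ t ∈ Icc 0 T, ∫ x, f t x = 1) {t : ℝ} (ht : t ∈ Icc 0 T) :
    relEntropy (f t) π ≠ ⊤ ∧
      HasDerivWithinAt (fun τ => (relEntropy (f τ) π).toReal)
        (∫ x, derivWithin (fun τ => f τ x) (Icc 0 T) t * Real.log (f t x / π x)) (Icc 0 T) t := by
  have h0 : (0 : ℝ) ∈ Icc 0 T := ⟨le_rfl, hT.le⟩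
  have hcont : ∀ τ ∈ Icc 0 T, Continuous (f τ) := fun τ hτ => (hf.contDiff_one hτ).continuous
  have hlogc : ∀ τ ∈ Icc 0 T, Continuous fun x => Real.log (f τ x / π x) := fun τ hτ =>
    ((hcont τ hτ).div hπ fun x => (hπ_pos x).ne').log
      fun x => (div_pos (hf.pos τ hτ x) (hπ_pos x)).ne'
  obtain ⟨g, hg, hdom⟩ := hf.dominated
  have hE0 := (relEntropy_ne_top_iff (hcont 0 h0) hπ (hf.pos 0 h0) hπ_pos hπ_one).1
    hf.entropy_ne_top
  have hderiv : ∀ τ ∈ Icc 0 T, ∀ x,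
      HasDerivWithinAt (fun τ => f τ x * Real.log (f τ x / π x))
        (derivWithin (fun τ => f τ x) (Icc 0 T) τ * (Real.log (f τ x / π x) + 1))
        (Icc 0 T) τ := by
    intro τ hτ x
    have h1 := hf.hasDerivWithinAt hτ x
    have h2 := h1.mul ((h1.div_const (π x)).log (div_pos (hf.pos τ hτ x) (hπ_pos x)).ne')
    refine h2.congr_deriv ?_
    have := (hf.pos τ hτ x).ne'
    have := (hπ_pos x).ne'
    field_simp
  have hle : ∀ τ ∈ Icc 0 T, ∀ x,
      |derivWithin (fun τ => f τ x) (Icc 0 T) τ * (Real.log (f τ x / π x) + 1)| ≤ g x := by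
    intro τ hτ x
    rw [abs_mul]
    refine le_trans (mul_le_mul_of_nonneg_left ?_ (abs_nonneg _)) (hdom τ hτ x)
    exact (abs_add_le _ _).trans (by rw [abs_one, add_comm])
  obtain ⟨hI, hD⟩ := hasDerivWithinAt_integral_of_dominated (μ := volume) ht h0
    (fun τ hτ => ((hcont τ hτ).mul (hlogc τ hτ)).aestronglyMeasurable) hE0 hg
    (ae_of_all _ fun x τ hτ => ⟨hderiv τ hτ x, hle τ hτ x⟩)
  obtain ⟨-, hM⟩ := hasDerivWithinAt_integral_of_dominated (μ := volume) ht h0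
    (fun τ hτ => (hcont τ hτ).aestronglyMeasurable)
    (Integrable.of_integral_ne_zero (by rw [hone 0 h0]; exact one_ne_zero)) hg
    (ae_of_all _ fun x τ hτ => ⟨hf.hasDerivWithinAt hτ x, abs_deriv_le (hdom τ hτ x)⟩)
  -- Conservation of mass; this removes the `+ 1` from the derivative of `f log (f / π)`.
  have hM0 : ∫ x, derivWithin (fun τ => f τ x) (Icc 0 T) t = 0 :=
    (uniqueDiffOn_Icc hT t ht).eq_deriv _ hM
      ((hasDerivWithinAt_const t (Icc 0 T) (1 : ℝ)).congr hone (hone t ht))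
  have hdt := hf.continuous_deriv hT ht
  have hi1 : Integrable fun x => derivWithin (fun τ => f τ x) (Icc 0 T) t :=
    hg.mono' hdt.aestronglyMeasurable (ae_of_all _ fun x => abs_deriv_le (hdom t ht x))
  have hi2 : Integrable fun x =>
      derivWithin (fun τ => f τ x) (Icc 0 T) t * (Real.log (f t x / π x) + 1) :=
    hg.mono' (hdt.mul ((hlogc t ht).add continuous_const)).aestronglyMeasurable
      (ae_of_all _ fun x => hle t ht x)
  have hval : ∫ x, derivWithin (fun τ => f τ x) (Icc 0 T) t * (Real.log (f t x / π x) + 1)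
      = ∫ x, derivWithin (fun τ => f τ x) (Icc 0 T) t * Real.log (f t x / π x) := by
    have h1 := integral_sub hi2 hi1
    rw [hM0, sub_zero] at h1
    rw [← h1]
    congr 1 with x
    ring
  rw [hval] at hD
  have hrel : ∀ τ ∈ Icc 0 T,
      (relEntropy (f τ) π).toReal = ∫ x, f τ x * Real.log (f τ x / π x) := fun τ hτ =>
    toReal_relEntropy (hcont τ hτ) hπ (hf.pos τ hτ) hπ_pos (hone τ hτ) hπ_one
  exact ⟨(relEntropy_ne_top_iff (hcont t ht) hπ (hf.pos t ht) hπ_pos hπ_one).2 (hI t ht),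
    hD.congr hrel (hrel t ht)⟩

end Entropy

/-! ### Weak transport and entropy dissipation -/

section Transport

variable {Ω : Type*} [MeasurableSpace Ω] {P : Measure Ω} [IsProbabilityMeasure P]
  {d : ℕ} {T : ℝ} {π : State d → ℝ} {f : ℝ → State d → ℝ} {X V : ℝ → Ω → State d} {B : ℝ}

/-- Weak form of the transport of the density by the random velocity `∇ log π - V`. -/
lemma RegularDensity.integral_testFunction (hf : RegularDensity T π f) (hT : 0 < T)
    (hπ : ContDiff ℝ 1 π) (hπ_pos : ∀ x, 0 < π x)
    (hone : ∀ t ∈ Icc 0 T, ∫ x, f t x = 1)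
    (hlaw : ∀ t ∈ Icc 0 T, HasLaw (X t) (densityMeasure (f t)) P)
    (hflow : ∀ᵐ ω ∂P, ∀ t ∈ Icc 0 T,
      HasDerivWithinAt (fun τ => X τ ω) (score π (X t ω) - V t ω) (Icc 0 T) t)
    (hB : ∀ᵐ ω ∂P, ∀ t ∈ Icc 0 T, ‖V t ω - score (f t) (X t ω)‖ ≤ B)
    {φ : State d → ℝ} (hφ : ContDiff ℝ 1 φ) (hφc : HasCompactSupport φ)
    {t : ℝ} (ht : t ∈ Icc 0 T) :
    ∫ x, derivWithin (fun τ => f τ x) (Icc 0 T) t * φ x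
      = ∫ ω, fderiv ℝ φ (X t ω) (score π (X t ω) - V t ω) ∂P := by
  have h0 : (0 : ℝ) ∈ Icc 0 T := ⟨le_rfl, hT.le⟩
  have hcont : ∀ τ ∈ Icc 0 T, Continuous (f τ) := fun τ hτ => (hf.contDiff_one hτ).continuous
  have hφ' : Continuous (fderiv ℝ φ) := hφ.continuous_fderiv one_ne_zero
  obtain ⟨K, hK⟩ := hφc.exists_bound_of_continuous hφ.continuous
  -- The speed is at most ‖∇log π‖ + B + ‖∇log f‖, which is bounded on the compact set `[0, T] ×
  -- supp φ`; off the support `∇φ` vanishes.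
  obtain ⟨M, hM⟩ := (isCompact_Icc.prod hφc).exists_bound_of_continuousOn (s := Icc 0 T ×ˢ tsupport φ)
    (f := fun p : ℝ × State d =>
      ‖fderiv ℝ φ p.2‖ * (‖score π p.2‖ + (B + ‖score (f p.1) p.2‖))) <| by
    have h1 : ContinuousOn (fun p : ℝ × State d => score (f p.1) p.2)
        (Icc 0 T ×ˢ tsupport φ) :=
      (differentiableOn_score hT hf.contDiff hf.pos).continuousOn.mono
        (prod_mono_right (subset_univ _))
    have h2 : Continuous (fun p : ℝ × State d => score π p.2) :=
      (continuous_score hπ hπ_pos).comp continuous_snd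
    have h3 : Continuous (fun p : ℝ × State d => fderiv ℝ φ p.2) := hφ'.comp continuous_snd
    exact h3.norm.continuousOn.mul (h2.norm.continuousOn.add (continuousOn_const.add h1.norm))
  -- differentiate `E φ(X)` along the trajectories
  obtain ⟨-, hleft⟩ := hasDerivWithinAt_integral_of_dominated (μ := P) ht h0
    (F := fun τ ω => φ (X τ ω))
    (F' := fun τ ω => fderiv ℝ φ (X τ ω) (score π (X τ ω) - V τ ω))
    -- The maximum with 0 covers points off the support, where `M` gives no information and may be
    -- negative.
    (bound := fun _ => max M 0)
    (fun τ hτ => (hφ.continuous.measurable.comp_aemeasurable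
      (hlaw τ hτ).aemeasurable).aestronglyMeasurable)
    (Integrable.of_bound (hφ.continuous.measurable.comp_aemeasurable
      (hlaw 0 h0).aemeasurable).aestronglyMeasurable K (ae_of_all _ fun ω => hK _))
    (integrable_const _) (by
      filter_upwards [hflow, hB] with ω h1 h2 τ hτ
      refine ⟨((hφ.differentiable one_ne_zero) _).hasFDerivAt.comp_hasDerivWithinAt τ (h1 τ hτ),
        ?_⟩
      by_cases hx : X τ ω ∈ tsupport φ
      · refine le_trans ?_ ((le_abs_self _).trans ((hM (τ, X τ ω) ⟨hτ, hx⟩).trans (le_max_left _ _)))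
        refine ((fderiv ℝ φ (X τ ω)).le_opNorm _).trans
          (mul_le_mul_of_nonneg_left ?_ (norm_nonneg _))
        refine (norm_sub_le _ _).trans (add_le_add_right ?_ _)
        exact (norm_le_norm_sub_add _ _).trans (add_le_add_left (h2 τ hτ) _)
      · have : fderiv ℝ φ (X τ ω) = 0 := by
          by_contra hne
          exact hx (support_fderiv_subset ℝ hne)
        simp [this])
  -- differentiate `∫ φ f`
  obtain ⟨g, hg, hdom⟩ := hf.dominated
  obtain ⟨-, hright⟩ := hasDerivWithinAt_integral_of_dominated (μ := volume) ht h0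
    (F := fun τ x => f τ x * φ x)
    (F' := fun τ x => derivWithin (fun τ => f τ x) (Icc 0 T) τ * φ x)
    (bound := fun x => g x * K)
    (fun τ hτ => ((hcont τ hτ).mul hφ.continuous).aestronglyMeasurable)
    ((Integrable.of_integral_ne_zero (by rw [hone 0 h0]; exact one_ne_zero)).mul_bdd
      hφ.continuous.aestronglyMeasurable (ae_of_all _ hK))
    (hg.mul_const K) (ae_of_all _ fun x τ hτ => ⟨(hf.hasDerivWithinAt hτ x).mul_const _, by
      have h1 := abs_deriv_le (hdom τ hτ x)
      rw [abs_mul]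
      exact mul_le_mul h1 (hK x) (abs_nonneg _) ((abs_nonneg _).trans h1)⟩)
  have heq : ∀ τ ∈ Icc 0 T, ∫ ω, φ (X τ ω) ∂P = ∫ x, f τ x * φ x := fun τ hτ => by
    rw [← integral_densityMeasure (hcont τ hτ) (hf.pos τ hτ),
      ← (hlaw τ hτ).integral_comp hφ.continuous.aestronglyMeasurable]
    rfl
  exact (uniqueDiffOn_Icc hT t ht).eq_deriv _ (hright.congr heq (heq t ht)) hleft

/-- Entropy dissipation along a particle driven by the approximate score `V`: the time derivative of
the relative entropy is at most `-F / 2` plus half of the mean squared error of the score. -/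
lemma RegularDensity.integral_deriv_mul_log_le (hf : RegularDensity T π f) (hT : 0 < T)
    (hπ : ContDiff ℝ 1 π) (hπ_pos : ∀ x, 0 < π x)
    (hone : ∀ t ∈ Icc 0 T, ∫ x, f t x = 1)
    (hlaw : ∀ t ∈ Icc 0 T, HasLaw (X t) (densityMeasure (f t)) P)
    (hflow : ∀ᵐ ω ∂P, ∀ t ∈ Icc 0 T,
      HasDerivWithinAt (fun τ => X τ ω) (score π (X t ω) - V t ω) (Icc 0 T) t)
    (hB : ∀ᵐ ω ∂P, ∀ t ∈ Icc 0 T, ‖V t ω - score (f t) (X t ω)‖ ≤ B)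
    {t : ℝ} (ht : t ∈ Icc 0 T) (hV : AEMeasurable (V t) P) :
    Integrable (fun ω => ‖V t ω - score (f t) (X t ω)‖ ^ 2) P ∧
    ∫ x, derivWithin (fun τ => f τ x) (Icc 0 T) t * Real.log (f t x / π x)
      ≤ -(1 / 2) * fisherInfo (f t) π
        + 1 / 2 * ∫ ω, ‖V t ω - score (f t) (X t ω)‖ ^ 2 ∂P := by
  have hft := hf.contDiff_one ht
  have hpos := hf.pos t ht
  set h : State d → ℝ := fun x => Real.log (f t x / π x) with hh
  have hhd : ContDiff ℝ 1 h := (hft.div hπ fun x => (hπ_pos x).ne').log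
    fun x => (div_pos (hpos x) (hπ_pos x)).ne'
  have hX := (hlaw t ht).aemeasurable
  have hcf := continuous_score hft hpos
  have hcπ := continuous_score hπ hπ_pos
  have hVs : AEMeasurable (fun ω => V t ω - score (f t) (X t ω)) P :=
    hV.sub (hcf.measurable.comp_aemeasurable hX)
  have hB2 : ∀ᵐ ω ∂P, ‖V t ω - score (f t) (X t ω)‖ ≤ B := by
    filter_upwards [hB] with ω hω using hω t ht
  have hint2 : Integrable (fun ω => ‖V t ω - score (f t) (X t ω)‖ ^ 2) P := by
    refine Integrable.of_bound (hVs.norm.pow_const 2).aestronglyMeasurable (B ^ 2) ?_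
    filter_upwards [hB2] with ω hω
    rw [norm_pow, norm_norm]
    exact pow_le_pow_left₀ (norm_nonneg _) hω 2
  refine ⟨hint2, ?_⟩
  have hgrad : ∀ x, gradient h x = score (f t) x - score π x :=
    gradient_log_div hft hπ hpos hπ_pos
  have hfd : ∀ x v, fderiv ℝ h x v = inner ℝ (score (f t) x - score π x) v := fun x v => by
    rw [← hgrad, gradient, InnerProductSpace.toDual_symm_apply]
  have hfdn : ∀ x, ‖fderiv ℝ h x‖ = ‖score (f t) x - score π x‖ := fun x => by
    rw [← hgrad, gradient, LinearIsometryEquiv.norm_map]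
  have hfd2 : ∀ x, fisherDensity (f t) π x = ‖score (f t) x - score π x‖ ^ 2 := fun x => by
    rw [← hgrad, fisherDensity]
  have hfish : Integrable (fun ω => ‖score (f t) (X t ω) - score π (X t ω)‖ ^ 2) P := by
    have h1 := hf.fisher t ht
    rw [← (hlaw t ht).map_eq] at h1
    have h2 := h1.comp_aemeasurable hX
    simpa only [Function.comp_def, hfd2] using h2
  have hfish_eq : ∫ ω, ‖score (f t) (X t ω) - score π (X t ω)‖ ^ 2 ∂P = fisherInfo (f t) π := by
    have h1 := (hlaw t ht).integral_comp (hf.fisher t ht).aestronglyMeasurable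
    rw [fisherInfo, ← h1]
    simp only [Function.comp_def, hfd2]
  set u : Ω → State d := fun ω => score (f t) (X t ω) - score π (X t ω) with hu
  set r : Ω → State d := fun ω => V t ω - score (f t) (X t ω) with hr
  have hu_meas : AEMeasurable u P :=
    (hcf.measurable.comp_aemeasurable hX).sub (hcπ.measurable.comp_aemeasurable hX)
  -- The velocity is the exact gradient flow velocity `-u` perturbed by the score error `r`.
  have hvel : ∀ ω, score π (X t ω) - V t ω = -u ω - r ω := fun ω => by
    simp only [hu, hr]
    abel
  have hu1 : Integrable (fun ω => ‖u ω‖) P := by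
    refine ((integrable_const (1 : ℝ)).add hfish).mono' hu_meas.norm.aestronglyMeasurable
      (ae_of_all _ fun ω => ?_)
    simp only [norm_norm, Pi.add_apply]
    nlinarith [sq_nonneg (‖u ω‖ - 1), norm_nonneg (u ω)]
  obtain ⟨C, φ, hC, hφd, hφc, hφle, hφlim, hφ'le, hφ'lim⟩ := exists_compactSupport_approx hhd
  have hweak := fun k => hf.integral_testFunction hT hπ hπ_pos hone hlaw hflow hB
    (hφd k) (hφc k) ht
  obtain ⟨g, hg, hdom⟩ := hf.dominated
  have hlim1 : Tendsto (fun k => ∫ x, derivWithin (fun τ => f τ x) (Icc 0 T) t * φ k x) atTop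
      (𝓝 (∫ x, derivWithin (fun τ => f τ x) (Icc 0 T) t * h x)) := by
    have hdt := hf.continuous_deriv hT ht
    refine tendsto_integral_of_dominated_convergence g
      (fun k => (hdt.mul (hφd k).continuous).aestronglyMeasurable) hg
      (fun k => ae_of_all _ fun x => ?_) (ae_of_all _ fun x => (hφlim x).const_mul _)
    rw [norm_mul]
    refine le_trans (mul_le_mul_of_nonneg_left ?_ (norm_nonneg _)) (hdom t ht x)
    exact (hφle k x).trans (le_add_of_nonneg_left zero_le_one)
  have hvel_meas : AEMeasurable (fun ω => (X t ω, score π (X t ω) - V t ω)) P :=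
    hX.prodMk ((hcπ.measurable.comp_aemeasurable hX).sub hV)
  have hmeas : ∀ ψ : State d → ℝ, ContDiff ℝ 1 ψ →
      AEStronglyMeasurable (fun ω => fderiv ℝ ψ (X t ω) (score π (X t ω) - V t ω)) P := by
    intro ψ hψ
    have h1 : Continuous (fun p : State d × State d => fderiv ℝ ψ p.1 p.2) :=
      ((hψ.continuous_fderiv one_ne_zero).comp continuous_fst).clm_apply continuous_snd
    exact (h1.measurable.comp_aemeasurable hvel_meas).aestronglyMeasurable
  -- Finite Fisher information makes `‖u‖` square integrable and `r` is bounded by `B`, so this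
  -- product dominates the truncated integrands uniformly in `k`.
  have hbound : Integrable (fun ω => (‖u ω‖ + C) * (‖u ω‖ + B)) P := by
    have : (fun ω => (‖u ω‖ + C) * (‖u ω‖ + B))
        = fun ω => ‖u ω‖ ^ 2 + (‖u ω‖ * (B + C) + C * B) := by
      ext ω
      ring
    rw [this]
    exact hfish.add ((hu1.mul_const _).add (integrable_const _))
  have hvel_le : ∀ᵐ ω ∂P,
      (‖fderiv ℝ h (X t ω)‖ + C) * ‖score π (X t ω) - V t ω‖ ≤ (‖u ω‖ + C) * (‖u ω‖ + B) := by
    filter_upwards [hB2] with ω hω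
    rw [hfdn, hvel]
    refine mul_le_mul_of_nonneg_left ?_ (by positivity)
    refine (norm_sub_le _ _).trans ?_
    rw [norm_neg]
    exact add_le_add_right hω _
  have hlim2 : Tendsto (fun k => ∫ ω, fderiv ℝ (φ k) (X t ω) (score π (X t ω) - V t ω) ∂P) atTop
      (𝓝 (∫ ω, fderiv ℝ h (X t ω) (score π (X t ω) - V t ω) ∂P)) := by
    refine tendsto_integral_of_dominated_convergence
      (fun ω => (‖u ω‖ + C) * (‖u ω‖ + B)) (fun k => hmeas _ (hφd k)) hbound (fun k => ?_)
      (ae_of_all _ fun ω => hφ'lim _ _)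
    filter_upwards [hvel_le] with ω hω using (hφ'le k _ _).trans hω
  have hint3 : Integrable (fun ω => fderiv ℝ h (X t ω) (score π (X t ω) - V t ω)) P := by
    refine hbound.mono' (hmeas h hhd) ?_
    filter_upwards [hvel_le] with ω hω
    refine ((fderiv ℝ h (X t ω)).le_opNorm _).trans (le_trans ?_ hω)
    exact mul_le_mul_of_nonneg_right (le_add_of_nonneg_right hC) (norm_nonneg _)
  have hEq : ∫ x, derivWithin (fun τ => f τ x) (Icc 0 T) t * h x
      = ∫ ω, fderiv ℝ h (X t ω) (score π (X t ω) - V t ω) ∂P := by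
    refine tendsto_nhds_unique hlim1 ?_
    simpa only [hweak] using hlim2
  rw [hEq, ← hfish_eq, ← integral_const_mul, ← integral_const_mul,
    ← integral_add (hfish.const_mul _) (hint2.const_mul _)]
  refine integral_mono hint3 ((hfish.const_mul _).add (hint2.const_mul _)) fun ω => ?_
  simp only [hfd, hvel]
  have h1 : inner ℝ (u ω) (-u ω - r ω) = -‖u ω‖ ^ 2 - inner ℝ (u ω) (r ω) := by
    rw [inner_sub_right, inner_neg_right, real_inner_self_eq_norm_sq]
  have h2 : -(‖u ω‖ * ‖r ω‖) ≤ inner ℝ (u ω) (r ω) := neg_le_of_abs_le (abs_real_inner_le_norm _ _)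
  change inner ℝ (u ω) (-u ω - r ω) ≤ -(1 / 2) * ‖u ω‖ ^ 2 + 1 / 2 * ‖r ω‖ ^ 2
  nlinarith [sq_nonneg (‖u ω‖ - ‖r ω‖)]

end Transport

/-! ### Grönwall and the conclusion -/

lemma fisherInfo_nonneg {d : ℕ} (ρ π : State d → ℝ) : 0 ≤ fisherInfo ρ π :=
  integral_nonneg fun _ => sq_nonneg _

/-- Grönwall's inequality in the form `u' ≤ -c u` on a closed interval. -/
lemma le_mul_exp_of_deriv_le {T c : ℝ} {u u' : ℝ → ℝ}
    (hu : ∀ t ∈ Icc 0 T, HasDerivWithinAt u (u' t) (Icc 0 T) t)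
    (hle : ∀ t ∈ Icc 0 T, u' t ≤ -c * u t) {t : ℝ} (ht : t ∈ Icc 0 T) :
    u t ≤ u 0 * Real.exp (-c * t) := by
  have hderiv : ∀ τ ∈ Icc 0 T, HasDerivWithinAt (fun τ => u τ * Real.exp (c * τ))
      (u' τ * Real.exp (c * τ) + u τ * (Real.exp (c * τ) * (c * 1))) (Icc 0 T) τ := fun τ hτ =>
    (hu τ hτ).mul (((hasDerivWithinAt_id τ _).const_mul c).exp)
  have hanti : AntitoneOn (fun τ => u τ * Real.exp (c * τ)) (Icc 0 T) := by
    refine antitoneOn_of_deriv_nonpos (convex_Icc 0 T)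
      (fun τ hτ => (hderiv τ hτ).continuousWithinAt) (fun τ hτ => ?_) (fun τ hτ => ?_)
    · exact ((hderiv τ (interior_subset hτ)).hasDerivAt
        (mem_interior_iff_mem_nhds.1 hτ)).differentiableAt.differentiableWithinAt
    · rw [((hderiv τ (interior_subset hτ)).hasDerivAt (mem_interior_iff_mem_nhds.1 hτ)).deriv]
      have h1 := mul_le_mul_of_nonneg_right (hle τ (interior_subset hτ)) (Real.exp_pos (c * τ)).le
      linarith
  have h := hanti ⟨le_rfl, ht.1.trans ht.2⟩ ht ht.1
  simp only [mul_zero, Real.exp_zero, mul_one] at h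
  rw [neg_mul, Real.exp_neg, ← div_eq_mul_inv]
  exact (le_div_iff₀ (Real.exp_pos _)).2 h

end SBTM

theorem mainTheorem1 {Ω : Type*} [MeasurableSpace Ω] (P : Measure Ω) [IsProbabilityMeasure P]
    {d n N : ℕ} (hn : 0 < n) (T : ℝ) (hT : 0 < T)
    -- the target density
    (π : State d → ℝ) (hπ_diff : ContDiff ℝ 1 π) (hπ_pos : ∀ x, 0 < π x) (hπ_one : ∫ x, π x = 1)
    -- the network
    (s : Weights N → State d → State d)
    (hs : Differentiable ℝ (fun p : Weights N × State d => s p.1 p.2))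
    -- the dynamics
    (η lam : ℝ → Ω → ℝ) (f : ℝ → State d → ℝ)
    (X : Fin n → ℝ → Ω → State d) (Θ : ℝ → Ω → Weights N)
    (hf : RegularDensity T π f)
    (hdyn : Dynamics P T π s η f X Θ)
    (htrain : SufficientTraining P T s η lam f X Θ)
    (ε : ℝ) (hε : ε = ⨅ t : Icc (0 : ℝ) T, fisherInfo (f t) π)
    -- the initial training loss is small
    (hinit : ∀ᵐ ω ∂P, empiricalLoss (s (Θ 0 ω)) (f 0) (fun i => X i 0 ω) ≤ ε / 4)
    -- the true loss is finite and well approximated by the training loss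
    (happrox : ∀ᵐ ω ∂P, ∀ t ∈ Icc 0 T,
      Integrable (fun x => ‖s (Θ t ω) x - score (f t) x‖ ^ 2) (densityMeasure (f t)) ∧
      |empiricalLoss (s (Θ t ω)) (f t) (fun i => X i t ω) - trueLoss (s (Θ t ω)) (f t)| ≤ ε / 4) :
    (∀ t ∈ Icc 0 T,
      relEntropy (f t) π ≠ ⊤ ∧
      DifferentiableWithinAt ℝ (fun τ => (relEntropy (f τ) π).toReal) (Icc 0 T) t ∧
      1 / 4 * fisherInfo (f t) π
        ≤ -derivWithin (fun τ => (relEntropy (f τ) π).toReal) (Icc 0 T) t) ∧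
    (∀ α : ℝ, 0 < α → LogSobolev π α → ∀ t ∈ Icc 0 T,
      relEntropy (f t) π
        ≤ relEntropy (f 0) π * ENNReal.ofReal (Real.exp (-(1 / (4 * α)) * t))) := by
  have hn' : (0 : ℝ) < n := by positivity
  have hcf : ∀ t ∈ Icc 0 T, Continuous (f t) := fun t ht => (hf.contDiff_one ht).continuous
  have hone : ∀ t ∈ Icc 0 T, ∫ x, f t x = 1 := fun t ht => by
    have := (hdyn.law ⟨0, hn⟩ t ht).isProbabilityMeasure_iff.1 inferInstance
    exact integral_eq_one_of_isProbabilityMeasure (hcf t ht) (hf.pos t ht)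
  have hεle : ∀ t ∈ Icc 0 T, ε ≤ fisherInfo (f t) π := fun t ht => by
    rw [hε]
    exact ciInf_le ⟨0, by rintro _ ⟨τ, rfl⟩; exact fisherInfo_nonneg _ _⟩
      (⟨t, ht⟩ : Icc (0 : ℝ) T)
  have hloss : ∀ᵐ ω ∂P, ∀ t ∈ Icc 0 T,
      empiricalLoss (s (Θ t ω)) (f t) (fun i => X i t ω) ≤ ε / 4 := by
    filter_upwards [hinit, hdyn.particle_flow, hdyn.weight_flow, htrain] with ω h1 h2 h3 h4 t ht
    exact (empiricalLoss_le_initial hT hn hf.contDiff hf.pos hs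
      (x' := fun i t => score π (X i t ω) - s (Θ t ω) (X i t ω)) (lam := fun t => lam t ω)
      h2 h3 h4 ht).trans h1
  have hB : ∀ i, ∀ᵐ ω ∂P, ∀ t ∈ Icc 0 T,
      ‖s (Θ t ω) (X i t ω) - score (f t) (X i t ω)‖ ≤ Real.sqrt (n * (ε / 4)) := by
    intro i
    filter_upwards [hloss] with ω hω t ht
    exact Real.le_sqrt_of_sq_le ((norm_sq_le_empiricalLoss hn (s (Θ t ω)) (f t)
      (fun i => X i t ω) i).trans (mul_le_mul_of_nonneg_left (hω t ht) hn'.le))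
  have hkey := fun t (ht : t ∈ Icc 0 T) =>
    hf.relEntropy_deriv hT hπ_diff.continuous hπ_pos hπ_one hone ht
  have hdiss : ∀ t ∈ Icc 0 T,
      ∫ x, derivWithin (fun τ => f τ x) (Icc 0 T) t * Real.log (f t x / π x)
        ≤ -(1 / 4 * fisherInfo (f t) π) := by
    intro t ht
    have hi := fun i => hf.integral_deriv_mul_log_le (P := P) (X := X i)
      (V := fun t ω => s (Θ t ω) (X i t ω)) hT hπ_diff hπ_pos hone (hdyn.law i)
      (by filter_upwards [hdyn.particle_flow] with ω hω t ht using hω t ht i) (hB i) ht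
      (hs.continuous.measurable.comp_aemeasurable
        ((hdyn.weights t ht).prodMk (hdyn.law i t ht).aemeasurable))
    set D := ∫ x, derivWithin (fun τ => f τ x) (Icc 0 T) t * Real.log (f t x / π x)
    -- Every particle has law `f t`, so the left side `D` is the same for each; summing assembles
    -- the errors into `n` times the empirical loss.
    have hsum := Finset.sum_le_sum fun i (_ : i ∈ Finset.univ) => (hi i).2
    rw [Finset.sum_add_distrib, ← Finset.mul_sum Finset.univ _ (1 / 2 : ℝ),
      ← integral_finsetSum _ fun i _ => (hi i).1]
      at hsum
    simp only [Finset.sum_const, Finset.card_univ, Fintype.card_fin, nsmul_eq_mul] at hsum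
    have hE : ∫ ω, ∑ i, ‖s (Θ t ω) (X i t ω) - score (f t) (X i t ω)‖ ^ 2 ∂P ≤ n * (ε / 4) := by
      refine (integral_mono_ae (integrable_finsetSum _ fun i _ => (hi i).1)
        (integrable_const (n * (ε / 4))) ?_).trans (by simp)
      filter_upwards [hloss] with ω hω
      have h := mul_le_mul_of_nonneg_left (hω t ht) hn'.le
      rwa [empiricalLoss, mul_inv_cancel_left₀ hn'.ne'] at h
    have h1 : D ≤ -(1 / 2) * fisherInfo (f t) π + 1 / 2 * (ε / 4) := by
      refine le_of_mul_le_mul_left ?_ hn'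
      linarith
    -- From `ε ≤ F`: -F/2 + ε/8 ≤ -3F/8 ≤ -F/4.
    linarith [hεle t ht, fisherInfo_nonneg (f t) π]
  refine ⟨fun t ht => ⟨(hkey t ht).1, (hkey t ht).2.differentiableWithinAt, ?_⟩, ?_⟩
  · rw [(hkey t ht).2.derivWithin (uniqueDiffOn_Icc hT t ht)]
    linarith [hdiss t ht]
  · intro α hα hLS t ht
    have hu := le_mul_exp_of_deriv_le (c := 1 / (4 * α)) (fun t ht => (hkey t ht).2)
      (fun t ht => by
        have h1 := hLS (f t) (hf.contDiff_one ht) (hf.pos t ht) (hone t ht) (hf.fisher t ht)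
        have h2 := ENNReal.toReal_le_of_le_ofReal
          (mul_nonneg hα.le (fisherInfo_nonneg (f t) π)) h1
        refine (hdiss t ht).trans ?_
        have h3 : 1 / (4 * α) * (relEntropy (f t) π).toReal
            ≤ 1 / (4 * α) * (α * fisherInfo (f t) π) :=
          mul_le_mul_of_nonneg_left h2 (by positivity)
        have h4 : 1 / (4 * α) * (α * fisherInfo (f t) π) = 1 / 4 * fisherInfo (f t) π := by
          field_simp
        linarith) ht
    rw [← ENNReal.ofReal_toReal (hkey t ht).1, ← ENNReal.ofReal_toReal hf.entropy_ne_top,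
      ← ENNReal.ofReal_mul ENNReal.toReal_nonneg]
    exact ENNReal.ofReal_le_ofReal hu
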